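/- For $m\ge 0$ and complex $a,q$ write $(a;q)_m=\prod_{j=0}^{m-1}(1-aq^j)$ and, when $|q|<1$, $(a;q)_\infty=\prod_{j=0}^{\infty}(1-aq^j)$ and $(a_1,a_2,a_3;q)_\infty=(a_1;q)_\infty(a_2;q)_\infty(a_3;q)_\infty$. Then for every complex number $q$ with $|q|<1$ the following double series converges absolutely, and $$\sum_{n,r\ge 0}\frac{q^{n^2+2nr+3r^2}\,(-q;q^2)_{n+r}}{(q^2;q^2)_n\,(q^2;q^2)_r\,(q^2;q^4)_r} =\frac{(q^{16},q^{20},q^{36};q^{36})_\infty\,(q^2;q^4)_\infty}{(q;q)_\infty} =\frac{(q^{16},q^{20},q^{36};q^{36})_\infty\,(-q;q^2)_\infty}{(q^2;q^2)_\infty}.$$ -/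

import Mathlib

/-- The finite rising `q`-factorial `(a; q)_m = ∏_{j=0}^{m-1} (1 - a q^j)`. -/
def qPoch (a q : ℂ) (m : ℕ) : ℂ := ∏ j ∈ Finset.range m, (1 - a * q ^ j)

/-- The infinite rising `q`-factorial `(a; q)_∞ = ∏_{j=0}^∞ (1 - a q^j)`. -/
noncomputable def qPochInf (a q : ℂ) : ℂ := ∏' j : ℕ, (1 - a * q ^ j)

/-- The abbreviation `(a₁, a₂, a₃; q)_∞ = (a₁; q)_∞ (a₂; q)_∞ (a₃; q)_∞`. -/
noncomputable def qPochInf₃ (a₁ a₂ a₃ q : ℂ) : ℂ :=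
  qPochInf a₁ q * qPochInf a₂ q * qPochInf a₃ q

/-- For `|q| < 1` the product defining `(a; q)_∞` converges, so `qPochInf` is its actual value. -/
theorem hasProd_qPochInf (a : ℂ) {q : ℂ} (hq : ‖q‖ < 1) :
    HasProd (fun j : ℕ => 1 - a * q ^ j) (qPochInf a q) := by
  have h : Multipliable fun j : ℕ => 1 + -(a * q ^ j) := by
    refine multipliable_one_add_of_summable ?_
    simp only [norm_neg, norm_mul, norm_pow]
    exact (summable_geometric_of_lt_one (norm_nonneg q) hq).mul_left _
  simpa only [qPochInf, sub_eq_add_neg] using h.hasProd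

/-! ### Convergence, nonvanishing and bounds for `q`-products. -/

open Filter Topology

/-! The double series comes from one Bailey pair relative to 1, carried through two steps of the
Bailey chain in base `q²`. Pairs are written bilaterally: β_r is a sum over integers `k` of weights
against 1/((q;q)_{r-k} (q;q)_{r+k}). In `tsum_invQFact_bailey_pair` the weights live on the even
indices `2k` and equal (-1)^k q^(3k²+k).

Put N = n + r, so that n² + 2nr + 3r² = N² + 2r². In base `q²`, the sum over `r` is the step with
both parameters infinite (`sum_range_invQFact`); it multiplies the weight at `2k` by q^(2(2k)²). The
sum over `N` is the step with one parameter infinite and the other `-q` (`tsum_qPoch_mul_invQFact`);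
it contributes q^((2k)²) and the factor (-q;q²)_∞/(q²;q²)_∞. What remains is the sum of (-1)^k
q^(18k²+2k), evaluated by the Jacobi triple product `tsum_theta`.

The finite identities are proved by recurrences, mostly from the splitting 1 - q^(m+n) = (1 - q^m) +
q^m (1 - q^n). -/

theorem qPoch_zero (a q : ℂ) : qPoch a q 0 = 1 := by simp [qPoch]

theorem qPoch_succ (a q : ℂ) (n : ℕ) : qPoch a q (n + 1) = qPoch a q n * (1 - a * q ^ n) := by
  simp [qPoch, Finset.prod_range_succ]

theorem one_sub_ne_zero_of_norm_lt_one {x : ℂ} (hx : ‖x‖ < 1) : 1 - x ≠ 0 := by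
  intro h
  rw [← sub_eq_zero.mp h] at hx
  simp at hx

theorem norm_sq_lt_one {q : ℂ} (hq : ‖q‖ < 1) : ‖q ^ 2‖ < 1 := by
  rw [norm_pow]; exact pow_lt_one₀ (norm_nonneg q) hq (by norm_num)

theorem norm_mul_pow_lt_one {a q : ℂ} (ha : ‖a‖ < 1) (hq : ‖q‖ < 1) (n : ℕ) :
    ‖a * q ^ n‖ < 1 := by
  rw [norm_mul, norm_pow]
  exact mul_lt_one_of_nonneg_of_lt_one_left (norm_nonneg a) ha
    (pow_le_one₀ (norm_nonneg q) hq.le)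

theorem qPoch_ne_zero {a q : ℂ} (ha : ‖a‖ < 1) (hq : ‖q‖ < 1) (n : ℕ) : qPoch a q n ≠ 0 :=
  Finset.prod_ne_zero_iff.mpr fun j _ =>
    one_sub_ne_zero_of_norm_lt_one (norm_mul_pow_lt_one ha hq j)

theorem summable_norm_mul_pow (a : ℂ) {q : ℂ} (hq : ‖q‖ < 1) :
    Summable fun j : ℕ => ‖a * q ^ j‖ := by
  simp only [norm_mul, norm_pow]
  exact (summable_geometric_of_lt_one (norm_nonneg q) hq).mul_left _

theorem qPochInf_ne_zero {a q : ℂ} (ha : ‖a‖ < 1) (hq : ‖q‖ < 1) : qPochInf a q ≠ 0 := by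
  have := tprod_one_add_ne_zero_of_summable (f := fun j : ℕ => -(a * q ^ j))
    (fun j => by
      simpa [sub_eq_add_neg] using one_sub_ne_zero_of_norm_lt_one (norm_mul_pow_lt_one ha hq j))
    (by simpa only [norm_neg] using summable_norm_mul_pow a hq)
  simpa only [qPochInf, sub_eq_add_neg] using this

theorem tendsto_qPoch (a : ℂ) {q : ℂ} (hq : ‖q‖ < 1) :
    Tendsto (qPoch a q) atTop (𝓝 (qPochInf a q)) :=
  (hasProd_qPochInf a hq).tendsto_prod_nat

theorem exists_norm_qPoch_le (a : ℂ) {q : ℂ} (hq : ‖q‖ < 1) : ∃ C, ∀ n, ‖qPoch a q n‖ ≤ C := by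
  obtain ⟨C, hC⟩ := (Metric.isBounded_range_of_tendsto _ (tendsto_qPoch a hq)).exists_norm_le
  exact ⟨C, fun n => hC _ ⟨n, rfl⟩⟩

theorem exists_norm_inv_qPoch_le {a q : ℂ} (ha : ‖a‖ < 1) (hq : ‖q‖ < 1) :
    ∃ C, ∀ n, ‖(qPoch a q n)⁻¹‖ ≤ C := by
  obtain ⟨C, hC⟩ := (Metric.isBounded_range_of_tendsto _
    ((tendsto_qPoch a hq).inv₀ (qPochInf_ne_zero ha hq))).exists_norm_le
  exact ⟨C, fun n => hC _ ⟨n, rfl⟩⟩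

/-! ### Reciprocal `q`-factorials at integer arguments. -/

/-- `1 / (q; q)_n`, extended by zero to negative integers `n`. -/
noncomputable def invQFact (q : ℂ) (n : ℤ) : ℂ := if n < 0 then 0 else (qPoch q q n.toNat)⁻¹

theorem invQFact_of_neg (q : ℂ) {n : ℤ} (hn : n < 0) : invQFact q n = 0 := if_pos hn

theorem invQFact_natCast (q : ℂ) (n : ℕ) : invQFact q n = (qPoch q q n)⁻¹ := by
  simp [invQFact]

theorem invQFact_zero (q : ℂ) : invQFact q 0 = 1 := by
  simpa [qPoch_zero] using invQFact_natCast q 0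

/-- The extension by zero keeps this recurrence valid at every integer: at `n = 0` the factor 1 -
q^0 vanishes along with the right side. Bilateral sums thus need no boundary terms. -/
theorem one_sub_zpow_mul_invQFact {q : ℂ} (hq : ‖q‖ < 1) (n : ℤ) :
    (1 - q ^ n) * invQFact q n = invQFact q (n - 1) := by
  rcases lt_trichotomy n 0 with hn | rfl | hn
  · rw [invQFact_of_neg q hn, invQFact_of_neg q (by lia), mul_zero]
  · rw [invQFact_of_neg q (show (0 : ℤ) - 1 < 0 by lia)]; simp
  · obtain ⟨m, rfl⟩ : ∃ m : ℕ, n = (m + 1 : ℕ) := ⟨(n - 1).toNat, by lia⟩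
    rw [show (((m + 1 : ℕ) : ℤ) - 1) = (m : ℕ) by push_cast; ring, invQFact_natCast,
      invQFact_natCast, qPoch_succ, zpow_natCast, pow_succ']
    have h1 := qPoch_ne_zero hq hq m
    have h2 := one_sub_ne_zero_of_norm_lt_one (norm_mul_pow_lt_one hq hq m)
    field_simp

theorem exists_norm_invQFact_le {q : ℂ} (hq : ‖q‖ < 1) :
    ∃ C, 0 ≤ C ∧ ∀ n, ‖invQFact q n‖ ≤ C := by
  obtain ⟨C, hC⟩ := exists_norm_inv_qPoch_le hq hq
  have h0 : 0 ≤ C := (norm_nonneg _).trans (hC 0)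
  refine ⟨C, h0, fun n => ?_⟩
  unfold invQFact
  split_ifs
  · simpa using h0
  · exact hC _

theorem tendsto_invQFact {q : ℂ} (hq : ‖q‖ < 1) :
    Tendsto (invQFact q) atTop (𝓝 (qPochInf q q)⁻¹) := by
  have h : Tendsto (fun n : ℤ => (qPoch q q n.toNat)⁻¹) atTop (𝓝 (qPochInf q q)⁻¹) :=
    ((tendsto_qPoch q hq).inv₀ (qPochInf_ne_zero hq hq)).comp
      (tendsto_atTop.mpr fun b => by
        filter_upwards [eventually_ge_atTop (b : ℤ)] with n hn
        lia)
  refine h.congr' ?_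
  filter_upwards [eventually_ge_atTop 0] with n hn
  simp [invQFact, not_lt.mpr hn]

/-- Splitting `1 - q^(m + n)` in a product of two reciprocal `q`-factorials. -/
theorem one_sub_zpow_add_mul_invQFact {q : ℂ} (hq : ‖q‖ < 1) (hq0 : q ≠ 0) (m n : ℤ) :
    (1 - q ^ (m + n)) * (invQFact q m * invQFact q n) =
      invQFact q (m - 1) * invQFact q n + q ^ m * (invQFact q m * invQFact q (n - 1)) := by
  rw [← one_sub_zpow_mul_invQFact hq m, ← one_sub_zpow_mul_invQFact hq n, zpow_add₀ hq0]
  ring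

/-- The two factors vanish outside a finite range of `k`, so the coefficients may be arbitrary. -/
theorem summable_mul_invQFact (q : ℂ) (c : ℤ → ℂ) (a b : ℤ) {t : ℤ} (ht : 0 < t) :
    Summable fun k : ℤ => c k * (invQFact q (a - t * k) * invQFact q (b + t * k)) := by
  refine summable_of_hasFiniteSupport ((Set.finite_Icc (-|b|) |a|).subset fun k hk => ?_)
  by_contra hk'
  apply hk
  beta_reduce
  rw [Set.mem_Icc, not_and_or, not_le, not_le] at hk'
  have ha := le_abs_self a
  have hb := neg_abs_le b
  have ha' := abs_nonneg a
  have hb' := abs_nonneg b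
  rcases hk' with h | h
  · rw [invQFact_of_neg q (show b + t * k < 0 by nlinarith [le_abs_self b])]; simp
  · rw [invQFact_of_neg q (show a - t * k < 0 by nlinarith)]; simp

theorem neg_one_zpow_neg (k : ℤ) : (-1 : ℂ) ^ (-k) = (-1) ^ k := by
  rw [zpow_neg, ← inv_zpow]; norm_num

theorem neg_one_zpow_neg_one_sub (k : ℤ) : (-1 : ℂ) ^ (-1 - k) = -(-1) ^ k := by
  rw [sub_eq_add_neg, zpow_add₀ (by norm_num), neg_one_zpow_neg, neg_one_zpow_neg]; simp

/-! ### The Bailey pair and the first Bailey step. -/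

section

variable {q : ℂ} (hq : ‖q‖ < 1) (hq0 : q ≠ 0)
include hq hq0

/-- Splitting 1 - q^(2r+2) gives two sums, and `k ↦ -k` turns the second into q^(r+1) times the
first. -/
theorem tsum_invQFact_even_step (r : ℤ) :
    (1 - q ^ (2 * r + 2)) * ∑' k : ℤ, (-1) ^ k * q ^ (3 * k ^ 2 + k) *
        (invQFact q (r + 1 - 2 * k) * invQFact q (r + 1 + 2 * k)) =
      (1 + q ^ (r + 1)) * ∑' k : ℤ, (-1) ^ k * q ^ (3 * k ^ 2 + k) *
        (invQFact q (r - 2 * k) * invQFact q (r + 1 + 2 * k)) := by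
  have hs1 := summable_mul_invQFact q (fun k => (-1) ^ k * q ^ (3 * k ^ 2 + k)) r (r + 1)
    (t := 2) (by norm_num)
  have hs2 := summable_mul_invQFact q
    (fun k => (-1) ^ k * q ^ (3 * k ^ 2 + k) * q ^ (r + 1 - 2 * k)) (r + 1) r
    (t := 2) (by norm_num)
  have hrefl : ∑' k : ℤ, (-1) ^ k * q ^ (3 * k ^ 2 + k) * q ^ (r + 1 - 2 * k) *
        (invQFact q (r + 1 - 2 * k) * invQFact q (r + 2 * k)) =
      q ^ (r + 1) * ∑' k : ℤ, (-1) ^ k * q ^ (3 * k ^ 2 + k) *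
        (invQFact q (r - 2 * k) * invQFact q (r + 1 + 2 * k)) := by
    rw [← tsum_mul_left, ← (Equiv.neg ℤ).tsum_eq]
    refine tsum_congr fun k => ?_
    simp only [Equiv.neg_apply, neg_one_zpow_neg]
    rw [mul_assoc ((-1 : ℂ) ^ k), ← zpow_add₀ hq0,
      show 3 * (-k) ^ 2 + -k + (r + 1 - 2 * -k) = (r + 1) + (3 * k ^ 2 + k) by ring,
      zpow_add₀ hq0, show r + 1 - 2 * -k = r + 1 + 2 * k by ring,
      show r + 2 * -k = r - 2 * k by ring]
    ring
  rw [add_mul, one_mul, ← hrefl, ← hs1.tsum_add hs2, ← tsum_mul_left]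
  refine tsum_congr fun k => ?_
  have h := one_sub_zpow_add_mul_invQFact hq hq0 (r + 1 - 2 * k) (r + 1 + 2 * k)
  rw [show r + 1 - 2 * k + (r + 1 + 2 * k) = 2 * r + 2 by ring,
    show r + 1 - 2 * k - 1 = r - 2 * k by ring,
    show r + 1 + 2 * k - 1 = r + 2 * k by ring] at h
  rw [mul_left_comm, h]
  ring

/-- Here the second sum of the splitting is antisymmetric under `k ↦ -1 - k`, hence zero. -/
theorem tsum_invQFact_odd_step (r : ℤ) :
    (1 - q ^ (2 * r + 1)) * ∑' k : ℤ, (-1) ^ k * q ^ (3 * k ^ 2 + k) *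
        (invQFact q (r - 2 * k) * invQFact q (r + 1 + 2 * k)) =
      ∑' k : ℤ, (-1) ^ k * q ^ (3 * k ^ 2 + k) *
        (invQFact q (r - 2 * k) * invQFact q (r + 2 * k)) := by
  have hs1 := summable_mul_invQFact q (fun k => (-1) ^ k * q ^ (3 * k ^ 2 + k)) r r
    (t := 2) (by norm_num)
  have hs2 := summable_mul_invQFact q
    (fun k => (-1) ^ k * q ^ (3 * k ^ 2 + k) * q ^ (r + 1 + 2 * k)) (r - 1) (r + 1)
    (t := 2) (by norm_num)
  have hzero : ∑' k : ℤ, (-1) ^ k * q ^ (3 * k ^ 2 + k) * q ^ (r + 1 + 2 * k) *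
        (invQFact q (r - 1 - 2 * k) * invQFact q (r + 1 + 2 * k)) = 0 := by
    rw [← self_eq_neg, ← tsum_neg]
    conv_lhs => rw [← (Equiv.subLeft (-1 : ℤ)).tsum_eq]
    refine tsum_congr fun k => ?_
    simp only [Equiv.subLeft_apply, neg_one_zpow_neg_one_sub]
    rw [mul_assoc (-(-1 : ℂ) ^ k), mul_assoc ((-1 : ℂ) ^ k), ← zpow_add₀ hq0, ← zpow_add₀ hq0,
      show 3 * (-1 - k) ^ 2 + (-1 - k) + (r + 1 + 2 * (-1 - k)) =
        3 * k ^ 2 + k + (r + 1 + 2 * k) by ring,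
      show r - 1 - 2 * (-1 - k) = r + 1 + 2 * k by ring,
      show r + 1 + 2 * (-1 - k) = r - 1 - 2 * k by ring]
    ring
  rw [← add_zero (∑' k : ℤ, _ * (_ * invQFact q (r + 2 * k))), ← hzero, ← hs1.tsum_add hs2,
    ← tsum_mul_left]
  refine tsum_congr fun k => ?_
  have h := one_sub_zpow_add_mul_invQFact hq hq0 (r + 1 + 2 * k) (r - 2 * k)
  rw [show r + 1 + 2 * k + (r - 2 * k) = 2 * r + 1 by ring,
    show r + 1 + 2 * k - 1 = r + 2 * k by ring,
    show r - 2 * k - 1 = r - 1 - 2 * k by ring] at h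
  rw [mul_left_comm, mul_comm (invQFact q (r - 2 * k)), h]
  ring

/-- The Bailey pair relative to `1` with `β_r = 1 / ((q; q)_r (q; q²)_r)`. -/
theorem tsum_invQFact_bailey_pair (r : ℕ) :
    ∑' k : ℤ, (-1) ^ k * q ^ (3 * k ^ 2 + k) *
        (invQFact q (r - 2 * k) * invQFact q (r + 2 * k)) =
      (qPoch q q r * qPoch q (q ^ 2) r)⁻¹ := by
  induction r with
  | zero =>
    rw [tsum_eq_single 0]
    · simp [invQFact_zero, qPoch_zero]
    · intro k hk
      rcases lt_or_gt_of_ne hk with h | h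
      · rw [invQFact_of_neg q (show ((0 : ℕ) : ℤ) + 2 * k < 0 by lia)]; simp
      · rw [invQFact_of_neg q (show ((0 : ℕ) : ℤ) - 2 * k < 0 by lia)]; simp
  | succ r ih =>
    have h1 := tsum_invQFact_even_step hq hq0 r
    have h2 := tsum_invQFact_odd_step hq hq0 r
    rw [ih] at h2
    rw [qPoch_succ, qPoch_succ, Nat.cast_succ]
    have e1 : q ^ (2 * (r : ℤ) + 2) = (q * q ^ r) * (q * q ^ r) := by
      rw [show 2 * (r : ℤ) + 2 = ((r + 1 + (r + 1) : ℕ) : ℤ) by push_cast; ring, zpow_natCast]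
      ring
    have e2 : q ^ (2 * (r : ℤ) + 1) = q * (q ^ 2) ^ r := by
      rw [show 2 * (r : ℤ) + 1 = ((2 * r + 1 : ℕ) : ℤ) by push_cast; ring, zpow_natCast]
      ring
    have e3 : q ^ ((r : ℤ) + 1) = q * q ^ r := by
      rw [zpow_add_one₀ hq0, zpow_natCast, mul_comm]
    rw [e1, e3] at h1
    rw [e2] at h2
    have hq2 := norm_sq_lt_one hq
    have hn := norm_mul_pow_lt_one hq hq r
    have n3 : 1 + q * q ^ r ≠ 0 := by
      have := one_sub_ne_zero_of_norm_lt_one (x := -(q * q ^ r)) (by rwa [norm_neg])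
      rwa [sub_neg_eq_add] at this
    have n4 := qPoch_ne_zero hq hq r
    have n5 := qPoch_ne_zero hq hq2 r
    -- 1 - q^(2r+2) = (1 - q^(r+1))(1 + q^(r+1)), and the second factor cancels.
    have h3 : (1 - q * q ^ r) * ∑' k : ℤ, (-1) ^ k * q ^ (3 * k ^ 2 + k) *
        (invQFact q ((r : ℤ) + 1 - 2 * k) * invQFact q ((r : ℤ) + 1 + 2 * k)) =
        ∑' k : ℤ, (-1) ^ k * q ^ (3 * k ^ 2 + k) *
        (invQFact q ((r : ℤ) - 2 * k) * invQFact q ((r : ℤ) + 1 + 2 * k)) := by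
      apply mul_left_cancel₀ n3
      rw [← h1]
      ring
    rw [← h3] at h2
    generalize ∑' k : ℤ, (-1) ^ k * q ^ (3 * k ^ 2 + k) *
      (invQFact q ((r : ℤ) + 1 - 2 * k) * invQFact q ((r : ℤ) + 1 + 2 * k)) = S at h2 ⊢
    refine eq_inv_of_mul_eq_one_right ?_
    calc _ = qPoch q q r * qPoch q (q ^ 2) r * ((1 - q * (q ^ 2) ^ r) * ((1 - q * q ^ r) * S)) := by
          ring
      _ = 1 := by rw [h2]; exact mul_inv_cancel₀ (mul_ne_zero n4 n5)

/-- Split 1 - q^M along M = s + (M - s) and shift `s` by one in the first half; the recurrence for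
the factor at s + m + 1 merges the halves. The sum `M + m` is preserved. -/
theorem tsum_invQFact_vandermonde_step (M m : ℤ) :
    (1 - q ^ M) * ∑' s : ℤ, q ^ (s * (s + m)) * invQFact q (s + m) *
        (invQFact q (M - s) * invQFact q s) =
      ∑' s : ℤ, q ^ (s * (s + (m + 1))) * invQFact q (s + (m + 1)) *
        (invQFact q (M - 1 - s) * invQFact q s) := by
  have hs1 : Summable fun s : ℤ => q ^ (s * (s + m)) * invQFact q (s + m) *
      (invQFact q (M - s) * invQFact q (s - 1)) := by
    simpa [add_comm, ← sub_eq_add_neg] using summable_mul_invQFact q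
      (fun s => q ^ (s * (s + m)) * invQFact q (s + m)) M (-1) (t := 1) (by norm_num)
  have hs2 : Summable fun s : ℤ => q ^ (s * (s + m)) * invQFact q (s + m) * q ^ s *
      (invQFact q (M - 1 - s) * invQFact q s) := by
    simpa using summable_mul_invQFact q
      (fun s => q ^ (s * (s + m)) * invQFact q (s + m) * q ^ s) (M - 1) 0 (t := 1) (by norm_num)
  have hs3 := (Equiv.addRight (1 : ℤ)).summable_iff.mpr hs1
  calc _ = ∑' s : ℤ, (q ^ (s * (s + m)) * invQFact q (s + m) *
        (invQFact q (M - s) * invQFact q (s - 1)) +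
        q ^ (s * (s + m)) * invQFact q (s + m) * q ^ s *
        (invQFact q (M - 1 - s) * invQFact q s)) := by
        rw [← tsum_mul_left]
        refine tsum_congr fun s => ?_
        have h := one_sub_zpow_add_mul_invQFact hq hq0 s (M - s)
        rw [add_sub_cancel, show M - s - 1 = M - 1 - s by ring] at h
        rw [mul_left_comm, mul_comm (invQFact q (M - s)), h]
        ring
    _ = _ := by
        rw [hs1.tsum_add hs2, ← (Equiv.addRight (1 : ℤ)).tsum_eq]
        refine (hs3.tsum_add hs2).symm.trans (tsum_congr fun s => ?_)
        have h := one_sub_zpow_mul_invQFact hq (s + (m + 1))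
        rw [show s + (m + 1) - 1 = s + m by ring] at h
        simp only [Function.comp_apply, Equiv.coe_addRight]
        rw [← h, show M - (s + 1) = M - 1 - s by ring, show s + 1 - 1 = s by ring,
          show s + 1 + m = s + (m + 1) by ring,
          show (s + 1) * (s + (m + 1)) = s * (s + m) + s + (s + (m + 1)) by ring,
          show s * (s + (m + 1)) = s * (s + m) + s by ring]
        simp only [zpow_add₀ hq0]
        ring

/-- A limiting case of the `q`-Chu–Vandermonde summation. -/
theorem tsum_invQFact_vandermonde (M m : ℤ) :
    ∑' s : ℤ, q ^ (s * (s + m)) * invQFact q (s + m) * (invQFact q (M - s) * invQFact q s) =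
      invQFact q M * invQFact q (M + m) := by
  have hneg : ∀ M' s : ℤ, M' ≤ 0 → M' < 0 ∨ s ≠ 0 →
      invQFact q (M' - s) * invQFact q s = 0 := by
    intro M' s hM' h
    rcases lt_or_ge s 0 with h' | h'
    · rw [invQFact_of_neg q h', mul_zero]
    · rw [invQFact_of_neg q (show M' - s < 0 by lia), zero_mul]
  rcases lt_or_ge M 0 with hM | hM
  · rw [invQFact_of_neg q hM, zero_mul]
    simp [hneg M _ hM.le (Or.inl hM)]
  obtain ⟨M, rfl⟩ := Int.eq_ofNat_of_zero_le hM
  clear hM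
  -- `m` must vary, since each step lowers `M` and raises `m`.
  induction M generalizing m with
  | zero =>
    rw [tsum_eq_single 0 fun s hs => by rw [hneg _ s (by simp) (Or.inr hs), mul_zero]]
    simp [invQFact_zero]
  | succ M ih =>
    have hz : (1 : ℂ) - q ^ ((M + 1 : ℕ) : ℤ) ≠ 0 := by
      rw [zpow_natCast]
      exact one_sub_ne_zero_of_norm_lt_one
        (by rw [norm_pow]; exact pow_lt_one₀ (norm_nonneg q) hq (by lia))
    apply mul_left_cancel₀ hz
    have h := one_sub_zpow_mul_invQFact hq ((M + 1 : ℕ) : ℤ)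
    rw [tsum_invQFact_vandermonde_step hq hq0, ← mul_assoc, h,
      show ((M + 1 : ℕ) : ℤ) - 1 = M by push_cast; ring, ih]
    push_cast
    ring_nf

/-- The Bailey lemma with both parameters infinite: `tsum_invQFact_vandermonde` at M = N - k, m =
2k, s = r - k, where k² + (r - k)(r + k) = r². -/
theorem sum_range_invQFact (N : ℕ) (k : ℤ) :
    ∑ r ∈ Finset.range (N + 1), q ^ (r ^ 2) * invQFact q (N - r) *
        (invQFact q (r - k) * invQFact q (r + k)) =
      q ^ (k ^ 2) * (invQFact q (N - k) * invQFact q (N + k)) := by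
  have h := tsum_invQFact_vandermonde hq hq0 (N - k) (2 * k)
  rw [show (N : ℤ) - k + 2 * k = N + k by ring] at h
  rw [← h, ← tsum_mul_left, ← (Equiv.subRight k).tsum_eq,
    tsum_eq_sum (s := (Finset.range (N + 1)).map Nat.castEmbedding) ?_, Finset.sum_map]
  · refine Finset.sum_congr rfl fun r _ => ?_
    simp only [Nat.castEmbedding_apply, Equiv.subRight_apply]
    rw [← mul_assoc (q ^ k ^ 2), ← mul_assoc (q ^ k ^ 2), ← zpow_add₀ hq0,
      ← zpow_natCast q (r ^ 2),
      show (r : ℤ) - k + 2 * k = r + k by ring, show (N : ℤ) - k - (r - k) = N - r by ring,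
      show k ^ 2 + (r - k) * (r + k) = ((r ^ 2 : ℕ) : ℤ) by push_cast; ring]
    ring
  · intro s hs
    simp only [Equiv.subRight_apply]
    rw [show s - k + 2 * k = s + k by ring, show (N : ℤ) - k - (s - k) = N - s by ring]
    -- For negative `s`, one of s + k and s - k is negative, according to the sign of `k`.
    rcases lt_or_ge s 0 with h0 | h0
    · rcases lt_or_ge k 0 with hk | hk
      · rw [invQFact_of_neg q (show s + k < 0 by lia)]; simp
      · rw [invQFact_of_neg q (show s - k < 0 by lia)]; simp
    · rw [invQFact_of_neg q (show (N : ℤ) - s < 0 from ?_)]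
      · simp
      · by_contra hc
        exact hs (Finset.mem_map.mpr ⟨s.toNat, by simp; lia, by simp [h0]⟩)

end

/-! ### The second Bailey step, through a `q`-Gauss type sum. -/

/-- The sum `∑ₛ q^(s² + 2ds) (-q; q²)_{j+s} / ((q²; q²)_s (q²; q²)_{s+j+d})`. -/
noncomputable def qGaussSum (q : ℂ) (j d : ℕ) : ℂ :=
  ∑' s : ℕ, q ^ (s ^ 2 + 2 * d * s) * qPoch (-q) (q ^ 2) (j + s) *
      ((qPoch (q ^ 2) (q ^ 2) s)⁻¹ * (qPoch (q ^ 2) (q ^ 2) (s + j + d))⁻¹)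

section

variable {q : ℂ} (hq : ‖q‖ < 1)
include hq

theorem exists_norm_gauss_term_le : ∃ C, ∀ d j m s : ℕ,
    ‖q ^ (s ^ 2 + 2 * d * s) * qPoch (-q) (q ^ 2) (j + s) *
      ((qPoch (q ^ 2) (q ^ 2) s)⁻¹ * (qPoch (q ^ 2) (q ^ 2) m)⁻¹)‖ ≤ C * ‖q‖ ^ s := by
  have hq2 := norm_sq_lt_one hq
  obtain ⟨A, hA⟩ := exists_norm_qPoch_le (-q) hq2
  obtain ⟨B, hB⟩ := exists_norm_inv_qPoch_le hq2 hq2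
  have hB0 := (norm_nonneg _).trans (hB 0)
  have hA0 := (norm_nonneg _).trans (hA 0)
  refine ⟨A * (B * B), fun d j m s => ?_⟩
  have h1 : ‖q‖ ^ (s ^ 2 + 2 * d * s) ≤ ‖q‖ ^ s :=
    pow_le_pow_of_le_one (norm_nonneg q) hq.le
      (by nlinarith [Nat.zero_le (d * s), Nat.le_self_pow two_ne_zero s])
  rw [norm_mul, norm_mul, norm_mul, norm_pow]
  calc _ ≤ ‖q‖ ^ s * A * (B * B) := by gcongr <;> first | exact hA _ | exact hB _
    _ = _ := by ring

theorem summable_gauss_term (d j : ℕ) (m : ℕ → ℕ) : Summable fun s : ℕ =>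
    q ^ (s ^ 2 + 2 * d * s) * qPoch (-q) (q ^ 2) (j + s) *
      ((qPoch (q ^ 2) (q ^ 2) s)⁻¹ * (qPoch (q ^ 2) (q ^ 2) (m s))⁻¹) := by
  obtain ⟨C, hC⟩ := exists_norm_gauss_term_le hq
  exact Summable.of_norm_bounded
    ((summable_geometric_of_lt_one (norm_nonneg q) hq).mul_left C) fun s => hC d j (m s) s

theorem inv_qPoch_eq_mul_inv_qPoch_succ (n : ℕ) :
    (qPoch q q n)⁻¹ = (1 - q ^ (n + 1)) * (qPoch q q (n + 1))⁻¹ := by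
  have h1 := qPoch_ne_zero hq hq n
  have h2 := one_sub_ne_zero_of_norm_lt_one (norm_mul_pow_lt_one hq hq n)
  rw [qPoch_succ, pow_succ']
  field_simp

/-- The difference of the two sides telescopes: its terms are t_s - t_{s+1}, where t_s is a
difference of summands for `d` and `d + 1` and carries 1 - q^(2s), so t_0 = 0. -/
theorem tsum_gauss_contiguous (j d : ℕ) :
    ∑' s : ℕ, q ^ (s ^ 2 + 2 * d * s) * qPoch (-q) (q ^ 2) (j + s) *
      ((qPoch (q ^ 2) (q ^ 2) s)⁻¹ * (qPoch (q ^ 2) (q ^ 2) (s + j + (d + 1)))⁻¹) =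
    (1 + q ^ (2 * d + 1) + q ^ (2 * j + 1) * q ^ (2 * d + 1)) * qGaussSum q j (d + 1) := by
  have hq2 := norm_sq_lt_one hq
  have hX := summable_gauss_term hq d j fun s => s + j + (d + 1)
  have hY := summable_gauss_term hq (d + 1) j fun s => s + j + (d + 1)
  have h0 := summable_gauss_term hq d j fun s => s + j + d
  have h1 := summable_gauss_term hq (d + 1) j fun s => s + j + d
  have hG := h0.sub h1
  have hG0 := hG.tsum_eq_zero_add
  have hG1 := (summable_nat_add_iff 1).mpr hG
  rw [qGaussSum, ← sub_eq_zero, ← tsum_mul_left, ← hX.tsum_sub (hY.mul_left _)]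
  simp only [ne_eq, OfNat.ofNat_ne_zero, not_false_eq_true, zero_pow, mul_zero, add_zero, pow_zero,
    sub_self, zero_add] at hG0
  rw [← sub_eq_zero, ← hG.tsum_sub hG1] at hG0
  rw [← hG0]
  refine tsum_congr fun s => ?_
  rw [inv_qPoch_eq_mul_inv_qPoch_succ hq2 (s + j + d),
    add_assoc (s + j) d 1, show s + 1 + j + d = s + j + (d + 1) by ring,
    inv_qPoch_eq_mul_inv_qPoch_succ hq2 s,
    show j + (s + 1) = j + s + 1 by ring, qPoch_succ (-q)]
  ring

theorem qGaussSum_succ_right (j d : ℕ) :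
    qGaussSum q j d = (1 + q ^ (2 * d + 1)) * qGaussSum q j (d + 1) := by
  have hX := summable_gauss_term hq d j fun s => s + j + (d + 1)
  have hY := summable_gauss_term hq (d + 1) j fun s => s + j + (d + 1)
  have h : qGaussSum q j d =
      ∑' s : ℕ, q ^ (s ^ 2 + 2 * d * s) * qPoch (-q) (q ^ 2) (j + s) *
        ((qPoch (q ^ 2) (q ^ 2) s)⁻¹ * (qPoch (q ^ 2) (q ^ 2) (s + j + (d + 1)))⁻¹) -
      q ^ (2 * j + 1) * q ^ (2 * d + 1) * qGaussSum q j (d + 1) := by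
    unfold qGaussSum
    rw [← tsum_mul_left, ← hX.tsum_sub (hY.mul_left _)]
    refine tsum_congr fun s => ?_
    rw [inv_qPoch_eq_mul_inv_qPoch_succ (norm_sq_lt_one hq) (s + j + d),
      add_assoc (s + j) d 1]
    ring
  rw [h, tsum_gauss_contiguous hq]
  ring

theorem qGaussSum_succ_left (j d : ℕ) :
    qGaussSum q (j + 1) d = (1 + q ^ (2 * j + 1)) * qGaussSum q j d := by
  have hX := summable_gauss_term hq d j fun s => s + j + (d + 1)
  have hY := summable_gauss_term hq (d + 1) j fun s => s + j + (d + 1)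
  have h : qGaussSum q (j + 1) d =
      ∑' s : ℕ, q ^ (s ^ 2 + 2 * d * s) * qPoch (-q) (q ^ 2) (j + s) *
        ((qPoch (q ^ 2) (q ^ 2) s)⁻¹ * (qPoch (q ^ 2) (q ^ 2) (s + j + (d + 1)))⁻¹) +
      q ^ (2 * j + 1) * qGaussSum q j (d + 1) := by
    unfold qGaussSum
    rw [← tsum_mul_left, ← hX.tsum_add (hY.mul_left _)]
    refine tsum_congr fun s => ?_
    rw [show j + 1 + s = j + s + 1 by ring, qPoch_succ (-q),
      show s + (j + 1) + d = s + j + (d + 1) by ring]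
    ring
  rw [h, tsum_gauss_contiguous hq, qGaussSum_succ_right hq j d]
  ring

/-- From (k, k), raising the first index multiplies by 1 + q^(2k+1) and raising the second divides
by it. -/
theorem qGaussSum_diag_eq_zero (k : ℕ) : qGaussSum q k k = qGaussSum q 0 0 := by
  induction k with
  | zero => rfl
  | succ k ih => rw [qGaussSum_succ_left hq, ← qGaussSum_succ_right hq, ih]

/-- The weight q^(s²+2ks) kills every term but s = 0 as `k` grows; the geometric bound, uniform in
`k`, justifies the termwise limit. -/
theorem tendsto_qGaussSum_diag :
    Tendsto (fun k => qGaussSum q k k) atTop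
      (𝓝 (qPochInf (-q) (q ^ 2) * (qPochInf (q ^ 2) (q ^ 2))⁻¹)) := by
  have hq2 := norm_sq_lt_one hq
  obtain ⟨C, hC⟩ := exists_norm_gauss_term_le hq
  have hlim : ∀ s : ℕ, Tendsto (fun k => q ^ (s ^ 2 + 2 * k * s) * qPoch (-q) (q ^ 2) (k + s) *
      ((qPoch (q ^ 2) (q ^ 2) s)⁻¹ * (qPoch (q ^ 2) (q ^ 2) (s + k + k))⁻¹)) atTop
      (𝓝 (if s = 0 then qPochInf (-q) (q ^ 2) * (qPochInf (q ^ 2) (q ^ 2))⁻¹ else 0)) := by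
    intro s
    have h1 : Tendsto (fun k => qPoch (-q) (q ^ 2) (k + s)) atTop (𝓝 (qPochInf (-q) (q ^ 2))) :=
      (tendsto_qPoch _ hq2).comp (tendsto_add_atTop_nat s)
    have h2 : Tendsto (fun k => (qPoch (q ^ 2) (q ^ 2) (s + k + k))⁻¹) atTop
        (𝓝 (qPochInf (q ^ 2) (q ^ 2))⁻¹) :=
      ((tendsto_qPoch _ hq2).inv₀ (qPochInf_ne_zero hq2 hq2)).comp
        (tendsto_atTop_mono (fun k => show k ≤ s + k + k by lia) tendsto_id)
    split_ifs with hs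
    · subst hs
      simpa [qPoch_zero] using h1.mul h2
    · have h3 : Tendsto (fun k => q ^ (s ^ 2 + 2 * k * s)) atTop (𝓝 0) :=
        (tendsto_pow_atTop_nhds_zero_of_norm_lt_one hq).comp
          (tendsto_atTop_mono (fun k => show k ≤ s ^ 2 + 2 * k * s by
            nlinarith [Nat.pos_of_ne_zero hs]) tendsto_id)
      simpa using (h3.mul h1).mul (h2.const_mul _)
  have := tendsto_tsum_of_dominated_convergence
    ((summable_geometric_of_lt_one (norm_nonneg q) hq).mul_left C) hlim
    (Eventually.of_forall fun k s => hC k k (s + k + k) s)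
  rwa [tsum_ite_eq] at this

theorem qGaussSum_diag (k : ℕ) :
    qGaussSum q k k = qPochInf (-q) (q ^ 2) * (qPochInf (q ^ 2) (q ^ 2))⁻¹ := by
  refine tendsto_nhds_unique ?_ (tendsto_qGaussSum_diag hq)
  rw [qGaussSum_diag_eq_zero hq]
  exact tendsto_const_nhds.congr fun n => (qGaussSum_diag_eq_zero hq n).symm

/-- The Bailey lemma with `ρ₁ → ∞`, `ρ₂ = -q` in base `q²`. -/
theorem tsum_qPoch_mul_invQFact (k : ℤ) :
    ∑' N : ℕ, q ^ (N ^ 2) * qPoch (-q) (q ^ 2) N *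
        (invQFact (q ^ 2) (N - k) * invQFact (q ^ 2) (N + k)) =
      q ^ (k.natAbs ^ 2) * (qPochInf (-q) (q ^ 2) * (qPochInf (q ^ 2) (q ^ 2))⁻¹) := by
  have key : ∀ k : ℕ, ∑' N : ℕ, q ^ (N ^ 2) * qPoch (-q) (q ^ 2) N *
        (invQFact (q ^ 2) (N - k) * invQFact (q ^ 2) (N + k)) =
      q ^ (k ^ 2) * (qPochInf (-q) (q ^ 2) * (qPochInf (q ^ 2) (q ^ 2))⁻¹) := by
    intro k
    -- Terms with N < k vanish; with N = s + k, N² = k² + (s² + 2ks).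
    rw [← qGaussSum_diag hq k, qGaussSum, ← tsum_mul_left,
      ← (add_left_injective k).tsum_eq (f := fun N : ℕ => q ^ (N ^ 2) * qPoch (-q) (q ^ 2) N *
        (invQFact (q ^ 2) (N - k) * invQFact (q ^ 2) (N + k)))]
    · refine tsum_congr fun s => ?_
      rw [show ((s + k : ℕ) : ℤ) - k = s by push_cast; ring,
        show ((s + k : ℕ) : ℤ) + k = (s + k + k : ℕ) by push_cast; ring, invQFact_natCast,
        invQFact_natCast, add_comm k s]
      ring
    · intro N hN
      by_contra hk
      apply hN
      have : (N : ℤ) - k < 0 := by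
        by_contra hc
        exact hk ⟨N - k, by simp; lia⟩
      simp [invQFact_of_neg _ this]
  rcases Int.natAbs_eq k with h | h
  · rw [h, key, Int.natAbs_natCast]
  · rw [h, Int.natAbs_neg, Int.natAbs_natCast, ← key]
    refine tsum_congr fun N => ?_
    rw [sub_neg_eq_add, ← sub_eq_add_neg, mul_comm (invQFact (q ^ 2) (N + (k.natAbs : ℤ)))]

end

/-! ### The Jacobi triple product. -/

section

variable {p w : ℂ} (hp : ‖p‖ < 1) (hp0 : p ≠ 0) (hw0 : w ≠ 0)
include hp hp0 hw0

/-- After the splitting, the shift `k ↦ k - 1` makes the second sum a multiple of the first. Each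
half step thus produces one linear factor of the product. -/
theorem tsum_theta_odd_step (n : ℤ) :
    (1 - p ^ (4 * n + 2)) * ∑' k : ℤ, (-1) ^ k * w ^ k * p ^ (k ^ 2) *
        (invQFact (p ^ 2) (n - k) * invQFact (p ^ 2) (n + 1 + k)) =
      (1 - w⁻¹ * p ^ (2 * n + 1)) * ∑' k : ℤ, (-1) ^ k * w ^ k * p ^ (k ^ 2) *
        (invQFact (p ^ 2) (n - k) * invQFact (p ^ 2) (n + k)) := by
  have hs1 : Summable fun k : ℤ => (-1) ^ k * w ^ k * p ^ (k ^ 2) *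
      (invQFact (p ^ 2) (n - k) * invQFact (p ^ 2) (n + k)) := by
    simpa using summable_mul_invQFact (p ^ 2) (fun k => (-1) ^ k * w ^ k * p ^ (k ^ 2)) n n
      (t := 1) (by norm_num)
  have hs2 : Summable fun k : ℤ => (-1) ^ k * w ^ k * p ^ (k ^ 2) * p ^ (2 * (n + 1 + k)) *
      (invQFact (p ^ 2) (n - 1 - k) * invQFact (p ^ 2) (n + 1 + k)) := by
    simpa using summable_mul_invQFact (p ^ 2)
      (fun k => (-1) ^ k * w ^ k * p ^ (k ^ 2) * p ^ (2 * (n + 1 + k))) (n - 1) (n + 1)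
      (t := 1) (by norm_num)
  have hshift : ∑' k : ℤ, (-1) ^ k * w ^ k * p ^ (k ^ 2) * p ^ (2 * (n + 1 + k)) *
      (invQFact (p ^ 2) (n - 1 - k) * invQFact (p ^ 2) (n + 1 + k)) =
      -(w⁻¹ * p ^ (2 * n + 1)) * ∑' k : ℤ, (-1) ^ k * w ^ k * p ^ (k ^ 2) *
        (invQFact (p ^ 2) (n - k) * invQFact (p ^ 2) (n + k)) := by
    rw [← tsum_mul_left, ← (Equiv.subRight (1 : ℤ)).tsum_eq]
    refine tsum_congr fun k => ?_
    simp only [Equiv.subRight_apply]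
    rw [show n - 1 - (k - 1) = n - k by ring, show n + 1 + (k - 1) = n + k by ring,
      mul_assoc (_ * _) (p ^ _) (p ^ _), ← zpow_add₀ hp0,
      show (k - 1) ^ 2 + 2 * (n + k) = (2 * n + 1) + k ^ 2 by ring, zpow_add₀ hp0,
      zpow_sub_one₀ hw0, zpow_sub_one₀ (by norm_num)]
    norm_num
    ring
  rw [sub_mul 1 (w⁻¹ * _), one_mul, sub_eq_add_neg (tsum _), ← neg_mul, ← hshift,
    ← hs1.tsum_add hs2, ← tsum_mul_left]
  refine tsum_congr fun k => ?_
  have h := one_sub_zpow_add_mul_invQFact (norm_sq_lt_one hp) (pow_ne_zero 2 hp0)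
    (n + 1 + k) (n - k)
  rw [show n + 1 + k + (n - k) = 2 * n + 1 by ring, show n + 1 + k - 1 = n + k by ring,
    show n - k - 1 = n - 1 - k by ring, ← zpow_natCast p 2, ← zpow_mul, ← zpow_mul] at h
  simp only [Nat.cast_ofNat, zpow_ofNat] at h
  rw [show 2 * (2 * n + 1) = 4 * n + 2 by ring] at h
  rw [mul_left_comm, mul_comm (invQFact (p ^ 2) (n - k)), h]
  ring

theorem tsum_theta_even_step (n : ℤ) :
    (1 - p ^ (4 * n + 4)) * ∑' k : ℤ, (-1) ^ k * w ^ k * p ^ (k ^ 2) *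
        (invQFact (p ^ 2) (n + 1 - k) * invQFact (p ^ 2) (n + 1 + k)) =
      (1 - w * p ^ (2 * n + 1)) * ∑' k : ℤ, (-1) ^ k * w ^ k * p ^ (k ^ 2) *
        (invQFact (p ^ 2) (n - k) * invQFact (p ^ 2) (n + 1 + k)) := by
  have hs1 : Summable fun k : ℤ => (-1) ^ k * w ^ k * p ^ (k ^ 2) *
      (invQFact (p ^ 2) (n - k) * invQFact (p ^ 2) (n + 1 + k)) := by
    simpa using summable_mul_invQFact (p ^ 2) (fun k => (-1) ^ k * w ^ k * p ^ (k ^ 2)) n (n + 1)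
      (t := 1) (by norm_num)
  have hs2 : Summable fun k : ℤ => (-1) ^ k * w ^ k * p ^ (k ^ 2) * p ^ (2 * (n + 1 - k)) *
      (invQFact (p ^ 2) (n + 1 - k) * invQFact (p ^ 2) (n + k)) := by
    simpa using summable_mul_invQFact (p ^ 2)
      (fun k => (-1) ^ k * w ^ k * p ^ (k ^ 2) * p ^ (2 * (n + 1 - k))) (n + 1) n
      (t := 1) (by norm_num)
  have hshift : ∑' k : ℤ, (-1) ^ k * w ^ k * p ^ (k ^ 2) * p ^ (2 * (n + 1 - k)) *
      (invQFact (p ^ 2) (n + 1 - k) * invQFact (p ^ 2) (n + k)) =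
      -(w * p ^ (2 * n + 1)) * ∑' k : ℤ, (-1) ^ k * w ^ k * p ^ (k ^ 2) *
        (invQFact (p ^ 2) (n - k) * invQFact (p ^ 2) (n + 1 + k)) := by
    rw [← tsum_mul_left, ← (Equiv.addRight (1 : ℤ)).tsum_eq]
    refine tsum_congr fun k => ?_
    simp only [Equiv.coe_addRight]
    rw [show n + 1 - (k + 1) = n - k by ring, show n + (k + 1) = n + 1 + k by ring,
      mul_assoc (_ * _) (p ^ _) (p ^ _), ← zpow_add₀ hp0,
      show (k + 1) ^ 2 + 2 * (n - k) = (2 * n + 1) + k ^ 2 by ring, zpow_add₀ hp0,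
      zpow_add_one₀ hw0, zpow_add_one₀ (by norm_num)]
    ring
  rw [sub_mul 1 (w * _), one_mul, sub_eq_add_neg (tsum _), ← neg_mul, ← hshift,
    ← hs1.tsum_add hs2, ← tsum_mul_left]
  refine tsum_congr fun k => ?_
  have h := one_sub_zpow_add_mul_invQFact (norm_sq_lt_one hp) (pow_ne_zero 2 hp0)
    (n + 1 - k) (n + 1 + k)
  rw [show n + 1 - k + (n + 1 + k) = 2 * n + 2 by ring, show n + 1 + k - 1 = n + k by ring,
    show n + 1 - k - 1 = n - k by ring, ← zpow_natCast p 2, ← zpow_mul, ← zpow_mul] at h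
  simp only [Nat.cast_ofNat, zpow_ofNat] at h
  rw [show 2 * (2 * n + 2) = 4 * n + 4 by ring] at h
  rw [mul_left_comm, h]
  ring

/-- The finite form of the Jacobi triple product identity. -/
theorem tsum_theta_finite (n : ℕ) :
    ∑' k : ℤ, (-1) ^ k * w ^ k * p ^ (k ^ 2) *
        (invQFact (p ^ 2) (n - k) * invQFact (p ^ 2) (n + k)) =
      qPoch (w * p) (p ^ 2) n * qPoch (w⁻¹ * p) (p ^ 2) n *
        (qPoch (p ^ 2) (p ^ 2) (2 * n))⁻¹ := by
  have hp2 := norm_sq_lt_one hp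
  induction n with
  | zero =>
    rw [tsum_eq_single 0]
    · simp [invQFact_zero, qPoch_zero]
    · intro k hk
      rcases lt_or_gt_of_ne hk with h | h
      · rw [invQFact_of_neg _ (show ((0 : ℕ) : ℤ) + k < 0 by lia)]; simp
      · rw [invQFact_of_neg _ (show ((0 : ℕ) : ℤ) - k < 0 by lia)]; simp
  | succ n ih =>
    have h1 := tsum_theta_odd_step hp hp0 hw0 n
    have h2 := tsum_theta_even_step hp hp0 hw0 n
    rw [ih] at h1
    have e1 : p ^ (4 * (n : ℤ) + 2) = p ^ 2 * (p ^ 2) ^ (2 * n) := by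
      rw [show 4 * (n : ℤ) + 2 = ((4 * n + 2 : ℕ) : ℤ) by push_cast; ring, zpow_natCast]
      ring
    have e2 : p ^ (4 * (n : ℤ) + 4) = p ^ 2 * (p ^ 2) ^ (2 * n + 1) := by
      rw [show 4 * (n : ℤ) + 4 = ((4 * n + 4 : ℕ) : ℤ) by push_cast; ring, zpow_natCast]
      ring
    have e3 : p ^ (2 * (n : ℤ) + 1) = p * (p ^ 2) ^ n := by
      rw [show 2 * (n : ℤ) + 1 = ((2 * n + 1 : ℕ) : ℤ) by push_cast; ring, zpow_natCast]
      ring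
    rw [e1, e3] at h1
    rw [e2, e3] at h2
    have n1 := one_sub_ne_zero_of_norm_lt_one (norm_mul_pow_lt_one hp2 hp2 (2 * n))
    have n2 := one_sub_ne_zero_of_norm_lt_one (norm_mul_pow_lt_one hp2 hp2 (2 * n + 1))
    rw [Nat.cast_succ, show 2 * (n + 1) = 2 * n + 1 + 1 by ring, qPoch_succ, qPoch_succ,
      qPoch_succ (p ^ 2), qPoch_succ (p ^ 2)]
    rw [(eq_div_iff n2).mpr ((mul_comm _ _).trans h2),
      (eq_div_iff n1).mpr ((mul_comm _ _).trans h1)]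
    field_simp

end

/-- The Jacobi triple product identity. -/
theorem tsum_theta {p w : ℂ} (hp : ‖p‖ < 1) (hp0 : p ≠ 0) (hw0 : w ≠ 0)
    (hs : Summable fun k : ℤ => ‖w ^ k * p ^ (k ^ 2)‖) :
    ∑' k : ℤ, (-1) ^ k * w ^ k * p ^ (k ^ 2) = qPochInf₃ (w * p) (w⁻¹ * p) (p ^ 2) (p ^ 2) := by
  have hp2 := norm_sq_lt_one hp
  have hne := qPochInf_ne_zero hp2 hp2
  obtain ⟨C, hC0, hC⟩ := exists_norm_invQFact_le hp2
  have hlim : ∀ k : ℤ, Tendsto (fun n : ℕ => (-1) ^ k * w ^ k * p ^ (k ^ 2) *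
      (invQFact (p ^ 2) (n - k) * invQFact (p ^ 2) (n + k))) atTop
      (𝓝 ((-1) ^ k * w ^ k * p ^ (k ^ 2) *
        ((qPochInf (p ^ 2) (p ^ 2))⁻¹ * (qPochInf (p ^ 2) (p ^ 2))⁻¹))) := by
    intro k
    have h1 := (tendsto_invQFact hp2).comp
      (tendsto_atTop_add_const_right atTop (-k) tendsto_natCast_atTop_atTop)
    have h2 := (tendsto_invQFact hp2).comp
      (tendsto_atTop_add_const_right atTop k tendsto_natCast_atTop_atTop)
    exact (h1.mul h2).const_mul _
  have hbound : ∀ (n : ℕ) (k : ℤ), ‖(-1) ^ k * w ^ k * p ^ (k ^ 2) *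
      (invQFact (p ^ 2) (n - k) * invQFact (p ^ 2) (n + k))‖ ≤
        ‖w ^ k * p ^ (k ^ 2)‖ * (C * C) := by
    intro n k
    rw [mul_assoc ((-1) ^ k), norm_mul, norm_mul, norm_mul (invQFact _ _), norm_zpow, norm_neg,
      norm_one, one_zpow, one_mul]
    gcongr <;> exact hC _
  have h1 := tendsto_tsum_of_dominated_convergence (hs.mul_right (C * C)) hlim
    (Eventually.of_forall hbound)
  simp only [tsum_theta_finite hp hp0 hw0] at h1
  have h2 := ((tendsto_qPoch (w * p) hp2).mul (tendsto_qPoch (w⁻¹ * p) hp2)).mul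
    (((tendsto_qPoch (p ^ 2) hp2).inv₀ hne).comp
      (tendsto_id.const_mul_atTop' (show 0 < 2 by norm_num)))
  have h3 := tendsto_nhds_unique h1 h2
  -- The limit carries 1/(p²;p²)_∞ twice on the left and once on the right; clearing these leaves
  -- one (p²;p²)_∞ in the product.
  rw [tsum_mul_right] at h3
  rw [qPochInf₃]
  generalize qPochInf (p ^ 2) (p ^ 2) = P, qPochInf (w * p) (p ^ 2) = A,
    qPochInf (w⁻¹ * p) (p ^ 2) = B at h3 hne ⊢
  field_simp at h3
  rw [h3]
  ring

/-! ### Equality of the two product forms. -/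

theorem qPochInf_eq_mul (a : ℂ) {q : ℂ} (hq : ‖q‖ < 1) :
    qPochInf a q = qPochInf a (q ^ 2) * qPochInf (a * q) (q ^ 2) := by
  have hq2 := norm_sq_lt_one hq
  have h := HasProd.even_mul_odd (f := fun j : ℕ => 1 - a * q ^ j)
    (m := qPochInf a (q ^ 2)) (m' := qPochInf (a * q) (q ^ 2))
    (by simpa only [pow_mul] using hasProd_qPochInf a hq2)
    (by
      convert hasProd_qPochInf (a * q) hq2 using 2
      ring)
  exact (hasProd_qPochInf a hq).unique h

theorem qPochInf_mul_neg (a : ℂ) {q : ℂ} (hq : ‖q‖ < 1) :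
    qPochInf a q * qPochInf (-a) q = qPochInf (a ^ 2) (q ^ 2) := by
  have h := (hasProd_qPochInf a hq).mul (hasProd_qPochInf (-a) hq)
  refine h.unique ?_
  convert hasProd_qPochInf (a ^ 2) (norm_sq_lt_one hq) using 2
  ring

/-- (q;q)_∞ = (q;q²)_∞ (q²;q²)_∞ and (q²;q⁴)_∞ = (q;q²)_∞ (-q;q²)_∞ share the factor (q;q²)_∞. -/
theorem qPochInf_quotient_eq {q : ℂ} (hq : ‖q‖ < 1) :
    qPochInf (q ^ 2) (q ^ 4) / qPochInf q q =
      qPochInf (-q) (q ^ 2) / qPochInf (q ^ 2) (q ^ 2) := by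
  have hq2 := norm_sq_lt_one hq
  have h1 := qPochInf_eq_mul q hq
  have h2 := qPochInf_mul_neg q hq2
  rw [← pow_mul] at h2
  rw [div_eq_div_iff (qPochInf_ne_zero hq hq) (qPochInf_ne_zero hq2 hq2), h1, ← h2, ← sq]
  ring

theorem summable_pow_natAbs {x : ℝ} (hx0 : 0 ≤ x) (hx : x < 1) :
    Summable fun k : ℤ => x ^ k.natAbs := by
  refine Summable.of_nat_of_neg ?_ ?_ <;>
    simpa using summable_geometric_of_lt_one hx0 hx

theorem norm_zpow_le_pow_natAbs {q : ℂ} (hq : ‖q‖ < 1) (hq0 : q ≠ 0) {m k : ℤ}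
    (h : (k.natAbs : ℤ) ≤ m) : ‖q ^ m‖ ≤ ‖q‖ ^ k.natAbs := by
  rw [norm_zpow, ← zpow_natCast]
  exact zpow_le_zpow_right_of_le_one₀ (norm_pos_iff.mpr hq0) hq.le h

theorem natAbs_le_sq (k : ℤ) : (k.natAbs : ℤ) ≤ k ^ 2 := by
  rw [Int.natCast_natAbs, ← sq_abs]
  nlinarith [sq_nonneg (|k| - 1), abs_nonneg k, Int.le_self_sq |k|]

theorem neg_le_sq (k : ℤ) : -k ≤ k ^ 2 := by
  simpa using Int.le_self_sq (-k)

/-! ### Evaluation of the double series. -/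

/-- The summand of the double series. -/
noncomputable def doubleTerm (q : ℂ) (p : ℕ × ℕ) : ℂ :=
  q ^ (p.1 ^ 2 + 2 * p.1 * p.2 + 3 * p.2 ^ 2) * qPoch (-q) (q ^ 2) (p.1 + p.2) /
    (qPoch (q ^ 2) (q ^ 2) p.1 * qPoch (q ^ 2) (q ^ 2) p.2 * qPoch (q ^ 2) (q ^ 4) p.2)

/-- The summand of the series over `N = n + r` and the index `k` of the Bailey pair. -/
noncomputable def baileyTerm (q : ℂ) (N : ℕ) (k : ℤ) : ℂ :=
  ((-1) ^ k * (q ^ 2) ^ (3 * k ^ 2 + k) * (q ^ 2) ^ ((2 * k) ^ 2)) *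
    (q ^ (N ^ 2) * qPoch (-q) (q ^ 2) N *
      (invQFact (q ^ 2) (N - 2 * k) * invQFact (q ^ 2) (N + 2 * k)))

section

variable {q : ℂ} (hq : ‖q‖ < 1)
include hq

theorem summable_doubleTerm : Summable (doubleTerm q) := by
  have hq2 := norm_sq_lt_one hq
  have hq4 : ‖q ^ 4‖ < 1 := by simpa [← pow_mul] using norm_sq_lt_one hq2
  obtain ⟨A, hA⟩ := exists_norm_qPoch_le (-q) hq2
  obtain ⟨B, hB⟩ := exists_norm_inv_qPoch_le hq2 hq2
  obtain ⟨D, hD⟩ := exists_norm_inv_qPoch_le hq2 hq4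
  have hA0 := (norm_nonneg _).trans (hA 0)
  have hB0 := (norm_nonneg _).trans (hB 0)
  have hD0 := (norm_nonneg _).trans (hD 0)
  have hg := summable_geometric_of_lt_one (norm_nonneg q) hq
  refine Summable.of_norm_bounded ((hg.mul_of_nonneg hg (fun _ => by positivity)
    (fun _ => by positivity)).mul_left (A * (B * B * D))) fun ⟨n, r⟩ => ?_
  have h : ‖q‖ ^ (n ^ 2 + 2 * n * r + 3 * r ^ 2) ≤ ‖q‖ ^ (n + r) :=
    pow_le_pow_of_le_one (norm_nonneg q) hq.le
      (by nlinarith [Nat.zero_le (n * r), Nat.le_self_pow two_ne_zero n,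
        Nat.le_self_pow two_ne_zero r])
  rw [doubleTerm, div_eq_mul_inv, mul_inv, mul_inv, norm_mul, norm_mul, norm_mul, norm_mul,
    norm_pow]
  calc _ ≤ ‖q‖ ^ (n + r) * A * (B * B * D) := by
        gcongr
        exacts [hA _, hB _, hB _, hD _]
    _ = _ := by rw [pow_add]; ring

theorem tsum_doubleTerm_eq_tsum_antidiagonal :
    ∑' p, doubleTerm q p = ∑' N : ℕ, ∑ p ∈ Finset.HasAntidiagonal.antidiagonal N, doubleTerm q p := by
  have hs := summable_doubleTerm hq
  rw [← Finset.HasAntidiagonal.sigmaAntidiagonalEquivProd.tsum_eq]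
  refine (Summable.tsum_sigma
    (Finset.HasAntidiagonal.sigmaAntidiagonalEquivProd.summable_iff.mpr hs)).trans
    (tsum_congr fun N => ?_)
  rw [tsum_fintype]
  exact Finset.sum_coe_sort (Finset.HasAntidiagonal.antidiagonal N) (doubleTerm q)

variable (hq0 : q ≠ 0)
include hq0

theorem sum_antidiagonal_doubleTerm (N : ℕ) :
    ∑ p ∈ Finset.HasAntidiagonal.antidiagonal N, doubleTerm q p = ∑' k : ℤ, baileyTerm q N k := by
  have hq2 := norm_sq_lt_one hq
  have hq20 := pow_ne_zero 2 hq0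
  rw [← Finset.Nat.sum_antidiagonal_swap, Finset.Nat.sum_antidiagonal_eq_sum_range_succ_mk]
  have hterm : ∀ r ∈ Finset.range (N + 1), doubleTerm q (Prod.swap (r, N - r)) =
      ∑' k : ℤ, q ^ (N ^ 2) * qPoch (-q) (q ^ 2) N *
        ((q ^ 2) ^ (r ^ 2) * invQFact (q ^ 2) (N - r)) *
        ((-1) ^ k * (q ^ 2) ^ (3 * k ^ 2 + k) *
          (invQFact (q ^ 2) (r - 2 * k) * invQFact (q ^ 2) (r + 2 * k))) := by
    intro r hr
    obtain ⟨n, rfl⟩ := Nat.exists_eq_add_of_le (Finset.mem_range_succ_iff.mp hr)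
    rw [tsum_mul_left, tsum_invQFact_bailey_pair hq2 hq20,
      show ((r + n : ℕ) : ℤ) - r = n by push_cast; ring, invQFact_natCast, Nat.add_sub_cancel_left,
      doubleTerm, Prod.swap, ← pow_mul q 2 2, add_comm r n, div_eq_mul_inv, mul_inv, mul_inv,
      mul_inv]
    ring
  rw [Finset.sum_congr rfl hterm, ← Summable.tsum_finsetSum]
  · refine tsum_congr fun k => ?_
    have h := sum_range_invQFact hq2 hq20 N (2 * k)
    rw [baileyTerm, mul_left_comm, mul_assoc (_ * _) ((q ^ 2) ^ (2 * k) ^ 2) (_ * _), ← h,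
      Finset.mul_sum, Finset.mul_sum]
    exact Finset.sum_congr rfl fun r _ => by ring
  · intro r _
    exact (summable_mul_invQFact (q ^ 2) (fun k => (-1) ^ k * (q ^ 2) ^ (3 * k ^ 2 + k)) r r
      (t := 2) (by norm_num)).mul_left _

/-- Allows the sums over `N` and `k` to be exchanged; the decay in `k` comes from 7k² + k ≥ |k|. -/
theorem summable_baileyTerm : Summable (Function.uncurry (baileyTerm q)) := by
  have hq2 := norm_sq_lt_one hq
  have hq20 := pow_ne_zero 2 hq0
  obtain ⟨A, hA⟩ := exists_norm_qPoch_le (-q) hq2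
  obtain ⟨B, hB0, hB⟩ := exists_norm_invQFact_le hq2
  have hA0 := (norm_nonneg _).trans (hA 0)
  have hg := summable_geometric_of_lt_one (norm_nonneg q) hq
  have hk := summable_pow_natAbs (norm_nonneg (q ^ 2)) hq2
  refine Summable.of_norm_bounded ((hg.mul_of_nonneg hk (fun _ => by positivity)
    (fun _ => by positivity)).mul_left (A * (B * B))) fun ⟨N, k⟩ => ?_
  have h1 : ‖q‖ ^ (N ^ 2) ≤ ‖q‖ ^ N :=
    pow_le_pow_of_le_one (norm_nonneg q) hq.le (Nat.le_self_pow two_ne_zero N)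
  have h2 : ‖(q ^ 2) ^ (3 * k ^ 2 + k + (2 * k) ^ 2)‖ ≤ ‖q ^ 2‖ ^ k.natAbs :=
    norm_zpow_le_pow_natAbs hq2 hq20 (by nlinarith [natAbs_le_sq k, neg_le_sq k, sq_nonneg k])
  rw [Function.uncurry_apply_pair, baileyTerm, mul_assoc ((-1) ^ k), ← zpow_add₀ hq20, norm_mul,
    norm_mul, norm_mul, norm_mul, norm_mul, norm_zpow, norm_neg, norm_one, one_zpow, one_mul,
    norm_pow q (N ^ 2)]
  calc _ ≤ ‖q ^ 2‖ ^ k.natAbs * (‖q‖ ^ N * A * (B * B)) := by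
        gcongr
        exacts [hA _, hB _, hB _]
    _ = _ := by ring

/-- The powers of `q` add up to 2(3k² + k) + 8k² + 4k² = 18k² + 2k. -/
theorem tsum_baileyTerm (k : ℤ) : ∑' N, baileyTerm q N k =
    (-1) ^ k * (q ^ 2) ^ k * (q ^ 18) ^ (k ^ 2) *
      (qPochInf (-q) (q ^ 2) / qPochInf (q ^ 2) (q ^ 2)) := by
  unfold baileyTerm
  rw [tsum_mul_left, tsum_qPoch_mul_invQFact hq, div_eq_mul_inv]
  have e : ∀ (a : ℕ) (m : ℤ), (q ^ a) ^ m = q ^ (a * m) := fun a m => by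
    rw [← zpow_natCast q a, ← zpow_mul]
  have h : (q ^ 2) ^ (3 * k ^ 2 + k) * (q ^ 2) ^ ((2 * k) ^ 2) * q ^ ((2 * k).natAbs ^ 2) =
      (q ^ 2) ^ k * (q ^ 18) ^ (k ^ 2) := by
    rw [← zpow_natCast q ((2 * k).natAbs ^ 2), e, e, e, e, ← zpow_add₀ hq0, ← zpow_add₀ hq0,
      ← zpow_add₀ hq0, Nat.cast_pow, Int.natCast_natAbs, sq_abs]
    congr 1
    push_cast
    ring
  rw [mul_assoc ((-1) ^ k) ((q ^ 2) ^ k), ← h]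
  ring

theorem tsum_theta_eighteen :
    ∑' k : ℤ, (-1) ^ k * (q ^ 2) ^ k * (q ^ 18) ^ (k ^ 2) =
      qPochInf₃ (q ^ 16) (q ^ 20) (q ^ 36) (q ^ 36) := by
  have hq2 := norm_sq_lt_one hq
  have hq20 := pow_ne_zero 2 hq0
  have h18 : ‖q ^ 18‖ < 1 := by
    rw [norm_pow]; exact pow_lt_one₀ (norm_nonneg q) hq (by norm_num)
  rw [tsum_theta h18 (pow_ne_zero 18 hq0) hq20]
  · rw [show (q ^ 2)⁻¹ * q ^ 18 = q ^ 16 by field_simp, ← pow_add, ← pow_mul, qPochInf₃, qPochInf₃]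
    ring
  · refine Summable.of_nonneg_of_le (fun _ => norm_nonneg _) (fun k => ?_)
      (summable_pow_natAbs (norm_nonneg (q ^ 2)) hq2)
    rw [show (q ^ 18) ^ k ^ 2 = (q ^ 2) ^ (9 * k ^ 2) by
      rw [zpow_mul, show q ^ 18 = (q ^ 2) ^ (9 : ℤ) by norm_cast; ring], ← zpow_add₀ hq20]
    exact norm_zpow_le_pow_natAbs hq2 hq20
      (by nlinarith [natAbs_le_sq k, neg_le_sq k, sq_nonneg k])

theorem tsum_doubleTerm : ∑' p, doubleTerm q p =
    qPochInf₃ (q ^ 16) (q ^ 20) (q ^ 36) (q ^ 36) *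
      (qPochInf (-q) (q ^ 2) / qPochInf (q ^ 2) (q ^ 2)) := by
  rw [tsum_doubleTerm_eq_tsum_antidiagonal hq]
  simp only [sum_antidiagonal_doubleTerm hq hq0]
  rw [← (summable_baileyTerm hq hq0).tsum_comm]
  simp only [tsum_baileyTerm hq hq0]
  rw [tsum_mul_right, tsum_theta_eighteen hq hq0]

end

theorem qPochInf_zero_left (q : ℂ) : qPochInf 0 q = 1 := by simp [qPochInf]

/-- The bilateral argument inverts powers of `q`, so q = 0 is settled directly. -/
theorem tsum_doubleTerm_zero : ∑' p, doubleTerm 0 p = 1 := by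
  rw [tsum_eq_single (0, 0)]
  · simp [doubleTerm, qPoch_zero]
  · rintro ⟨n, r⟩ h
    have : n ^ 2 + 2 * n * r + 3 * r ^ 2 ≠ 0 := by
      intro h0
      apply h
      simp_all
    simp only [doubleTerm]
    rw [zero_pow this]
    simp

theorem mainTheorem5 (q : ℂ) (hq : ‖q‖ < 1) :
    HasSum
      (fun p : ℕ × ℕ =>
        q ^ (p.1 ^ 2 + 2 * p.1 * p.2 + 3 * p.2 ^ 2) * qPoch (-q) (q ^ 2) (p.1 + p.2) /
          (qPoch (q ^ 2) (q ^ 2) p.1 * qPoch (q ^ 2) (q ^ 2) p.2 * qPoch (q ^ 2) (q ^ 4) p.2))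
      (qPochInf₃ (q ^ 16) (q ^ 20) (q ^ 36) (q ^ 36) * qPochInf (q ^ 2) (q ^ 4) / qPochInf q q) ∧
    qPochInf₃ (q ^ 16) (q ^ 20) (q ^ 36) (q ^ 36) * qPochInf (q ^ 2) (q ^ 4) / qPochInf q q =
      qPochInf₃ (q ^ 16) (q ^ 20) (q ^ 36) (q ^ 36) * qPochInf (-q) (q ^ 2) /
        qPochInf (q ^ 2) (q ^ 2) := by
  have heq : qPochInf₃ (q ^ 16) (q ^ 20) (q ^ 36) (q ^ 36) * qPochInf (q ^ 2) (q ^ 4) /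
      qPochInf q q = qPochInf₃ (q ^ 16) (q ^ 20) (q ^ 36) (q ^ 36) * qPochInf (-q) (q ^ 2) /
        qPochInf (q ^ 2) (q ^ 2) := by
    rw [mul_div_assoc, qPochInf_quotient_eq hq, mul_div_assoc]
  refine ⟨?_, heq⟩
  rw [heq, mul_div_assoc]
  have hs := (summable_doubleTerm hq).hasSum
  rcases eq_or_ne q 0 with rfl | hq0
  · rw [tsum_doubleTerm_zero] at hs
    change HasSum (doubleTerm 0) _
    simpa [qPochInf₃, qPochInf_zero_left] using hs
  · rwa [tsum_doubleTerm hq hq0] at hs
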